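/- **Conventions.** Let $\mathcal X$ be a finite non-empty alphabet and $\mathcal X^*$ the set of finite strings over it, $\epsilon$ the empty string. Strings, pairs of strings and rational numbers are coded effectively by natural numbers. A set $A$ is $\Sigma^0_n$ if there is a computable relation $S$ with $k\in A\iff\exists k_1\forall k_2\cdots Q_nk_n\,S(k,k_1,\dots,k_n)$, and $\Pi^0_n$ if its complement is $\Sigma^0_n$. A real-valued function $f$ is $\Sigma^0_n$-computable if $\{(x,q): q\in\mathbb Q,\ f(x)>q\}$ is $\Sigma^0_n$; it is $\Pi^0_n$-computable if $\{(x,q): q\in\mathbb Q,\ f(x)\ge q\}$ is $\Pi^0_n$ (equivalently, for $n\ge1$, if $\{(x,q): f(x)<q\}$ is $\Sigma^0_n$); it is $\Delta^0_n$-computable if it is both. Lower semicomputable means $\Sigma^0_1$-computable and limit computable means $\Delta^0_2$-computable. A monotone Turing machine $T$ has a one-way read-only binary input tape, finitely many work tapes and a one-way write-only output tape over $\mathcal X$; for $p\in\{0,1\}^*$ let $T(p)$ be the finite or infinite string that it writes without reading more input than $p$, and write $x\sqsubseteq T(p)$ if $x$ is a prefix of $T(p)$. A monotone machine $U$ is universal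 if for every monotone machine $T$ there is $c\in\{0,1\}^*$ with $U(cp)=T(p)$ for all $p$. Let $U$ be a universal monotone Turing machine. Solomonoff's prior is $M(x):=\sum_p2^{-|p|}$, where $p$ ranges over the minimal programs for $x$ (that is, $x\sqsubseteq U(p)$ and $x\not\sqsubseteq U(p')$ for every proper prefix $p'$ of $p$); this is the probability that $U$ outputs a string starting with $x$ when fed with uniformly random bits. The measure mixture is $\overline M(x):=\lim_{n\to\infty}\sum_{y\in\mathcal X^n}M(xy)$. For $\nu\in\{M,\overline M\}$ the normalization $\nu_{\mathrm{norm}}$ is given by $\nu_{\mathrm{norm}}(\epsilon):=1$ and $\nu_{\mathrm{norm}}(xa):=\nu_{\mathrm{norm}}(x)\,\nu(xa)/\sum_{b\in\mathcal X}\nu(xb)$ for $x\in\mathcal X^*$, $a\in\mathcal X$. Conditionals are $\nu(xy\mid x):=\nu(xy)/\nu(x)$, regarded as functions of $(x,y)\in\mathcal X^*\times\mathcal X^*$. **Theorem 1** (Complexity of $M$, $M_{\mathrm{norm}}$, $\overline M$ and $\overline M_{\mathrm{norm}}$). 1. $M(x)$ is lower semicomputable. 2. $M(xy\mid x)$ is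 limit computable. 3. $M_{\mathrm{norm}}(x)$ is limit computable. 4. $M_{\mathrm{norm}}(xy\mid x)$ is limit computable. 5. $\overline M(x)$ is $\Pi^0_2$-computable. 6. $\overline M(xy\mid x)$ is $\Delta^0_3$-computable. 7. $\overline M_{\mathrm{norm}}(x)$ is $\Delta^0_3$-computable. 8. $\overline M_{\mathrm{norm}}(xy\mid x)$ is $\Delta^0_3$-computable. -/

import Mathlib

open Filter Topology
open scoped BigOperators

/-! ### The encoding of rational numbers -/

/-- A rational number is coded by the pair of its numerator and denominator in lowest terms (this is
Mathlib's `Encodable ℚ`); the set of codes is primitive recursive. -/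
theorem Rat.prim_encode_decode :
    Nat.Primrec fun n => Encodable.encode (Encodable.decode n : Option ℚ) := by
  have key : ∀ n : ℕ, Encodable.encode (Encodable.decode n : Option ℚ) =
      if 0 < n.unpair.2 ∧ ∀ k < n.unpair.2 + 1,
        ¬(((n.unpair.1 + 1) / 2) % k = 0 ∧ n.unpair.2 % k = 0) ∨ k = 1 then n + 1 else 0 := by
    intro n
    have hz : ∀ m : ℕ, (Equiv.intEquivNat.symm m).natAbs = (m + 1) / 2 := by
      intro m
      obtain ⟨z, rfl⟩ := Equiv.intEquivNat.surjective m
      rw [Equiv.symm_apply_apply]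
      cases z with
      | ofNat k =>
        change k = (Nat.bit false k + 1) / 2
        rw [Nat.bit_val]
        simp
        omega
      | negSucc k =>
        change k + 1 = (Nat.bit true k + 1) / 2
        rw [Nat.bit_val]
        simp
        omega
    have hc : (0 < n.unpair.2 ∧ ∀ k < n.unpair.2 + 1,
        ¬(((n.unpair.1 + 1) / 2) % k = 0 ∧ n.unpair.2 % k = 0) ∨ k = 1) ↔
        0 < n.unpair.2 ∧ (Equiv.intEquivNat.symm n.unpair.1).natAbs.Coprime n.unpair.2 := by
      rw [hz]
      refine and_congr_right fun hb => ⟨fun h => ?_, fun h k _ => ?_⟩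
      · have := h (((n.unpair.1 + 1) / 2).gcd n.unpair.2)
          (Nat.lt_succ_of_le (Nat.gcd_le_right _ hb))
        simpa [Nat.mod_eq_zero_of_dvd, Nat.gcd_dvd_left, Nat.gcd_dvd_right] using this
      · by_contra hk
        push Not at hk
        exact hk.2 (Nat.eq_one_of_dvd_coprimes h (Nat.dvd_of_mod_eq_zero hk.1.1)
          (Nat.dvd_of_mod_eq_zero hk.1.2))
    rw [if_congr hc rfl rfl]
    split_ifs with h
    · have hq : n = Encodable.encode
          (⟨Equiv.intEquivNat.symm n.unpair.1, n.unpair.2, h.1.ne', h.2⟩ : ℚ) := by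
        change n = Nat.pair (Equiv.intEquivNat (Equiv.intEquivNat.symm n.unpair.1)) n.unpair.2
        rw [Equiv.apply_symm_apply, Nat.pair_unpair]
      have hd : (Encodable.decode n : Option ℚ) = some
          ⟨Equiv.intEquivNat.symm n.unpair.1, n.unpair.2, h.1.ne', h.2⟩ :=
        (congrArg Encodable.decode hq).trans (Encodable.encodek _)
      rw [hd, Encodable.encode_some, ← hq]
    · have hn : Encodable.decodeSubtype (P := fun d : ℕ => 0 < d ∧
          (Equiv.intEquivNat.symm n.unpair.1).natAbs.Coprime d) n.unpair.2 = none := by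
        unfold Encodable.decodeSubtype
        rw [Encodable.decode_nat, Option.bind_some, dif_neg h]
      have hs : Encodable.decodeSigma
          (γ := fun z : ℤ => {d : ℕ // 0 < d ∧ z.natAbs.Coprime d}) n = none :=
        congrArg (Option.map (Sigma.mk
          (β := fun z : ℤ => {d : ℕ // 0 < d ∧ z.natAbs.Coprime d}) _)) hn
      have hd : (Encodable.decode n : Option ℚ) = none := congrArg (fun o => Option.bind o _) hs
      rw [hd, Encodable.encode_none]
  have h1 : Primrec fun n : ℕ => n.unpair.1 := Primrec.fst.comp Primrec.unpair
  have h2 : Primrec fun n : ℕ => n.unpair.2 := Primrec.snd.comp Primrec.unpair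
  have hR : PrimrecRel fun k n : ℕ =>
      ¬(((n.unpair.1 + 1) / 2) % k = 0 ∧ n.unpair.2 % k = 0) ∨ k = 1 := by
    refine PrimrecPred.or (PrimrecPred.not (PrimrecPred.and ?_ ?_)) ?_
    · exact Primrec.eq.comp (Primrec.nat_mod.comp (Primrec.nat_div.comp (Primrec.succ.comp
        (h1.comp Primrec.snd)) (Primrec.const 2)) Primrec.fst) (Primrec.const 0)
    · exact Primrec.eq.comp (Primrec.nat_mod.comp (h2.comp Primrec.snd) Primrec.fst)
        (Primrec.const 0)
    · exact Primrec.eq.comp Primrec.fst (Primrec.const 1)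
  refine Primrec.nat_iff.1 (Primrec.of_eq ?_ fun n => (key n).symm)
  refine Primrec.ite (PrimrecPred.and ?_ ?_) Primrec.succ (Primrec.const 0)
  · exact Primrec.nat_lt.comp (Primrec.const 0) h2
  · exact hR.forall_lt.comp (Primrec.succ.comp h2) Primrec.id

instance Rat.instPrimcodable : Primcodable ℚ where
  toEncodable := inferInstance
  prim := Rat.prim_encode_decode

/-! ### The arithmetical hierarchy -/

/-- Quantifier prefixes of length `n` over `ℕ`, strictly alternating:
`AltQuant true n S` is `∃ k₁, ∀ k₂, ∃ k₃, …, S (k₁, …, kₙ)`, and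
`AltQuant false n S` is `∀ k₁, ∃ k₂, ∀ k₃, …, S (k₁, …, kₙ)`. -/
def AltQuant : Bool → (n : ℕ) → (List.Vector ℕ n → Prop) → Prop
  | _, 0, S => S List.Vector.nil
  | true, n + 1, S => ∃ k, AltQuant false n fun v => S (k ::ᵥ v)
  | false, n + 1, S => ∀ k, AltQuant true n fun v => S (k ::ᵥ v)

/-- `A` is `Σ⁰ₙ`. -/
def IsSigma {α : Type*} [Primcodable α] (n : ℕ) (A : Set α) : Prop :=
  ∃ S : α → List.Vector ℕ n → Prop,
    (ComputablePred fun p : α × List.Vector ℕ n => S p.1 p.2) ∧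
      ∀ a, a ∈ A ↔ AltQuant true n (S a)

/-- `A` is `Π⁰ₙ`: its complement is `Σ⁰ₙ`. -/
def IsPi {α : Type*} [Primcodable α] (n : ℕ) (A : Set α) : Prop :=
  IsSigma n Aᶜ

/-! ### Computability of real-valued functions -/

/-- `f` is `Σ⁰ₙ`-computable: the rational strict lower bounds of `f` form a `Σ⁰ₙ` relation. -/
def SigmaComputable {α : Type*} [Primcodable α] (n : ℕ) (f : α → ℝ) : Prop :=
  IsSigma n {p : α × ℚ | f p.1 > (p.2 : ℝ)}

/-- `f` is `Π⁰ₙ`-computable: the rational weak lower bounds of `f` form a `Π⁰ₙ` relation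
(equivalently, the rational strict upper bounds of `f` form a `Σ⁰ₙ` relation). -/
def PiComputable {α : Type*} [Primcodable α] (n : ℕ) (f : α → ℝ) : Prop :=
  IsPi n {p : α × ℚ | f p.1 ≥ (p.2 : ℝ)}

/-- `f` is `Δ⁰ₙ`-computable. -/
def DeltaComputable {α : Type*} [Primcodable α] (n : ℕ) (f : α → ℝ) : Prop :=
  SigmaComputable n f ∧ PiComputable n f

/-- Lower semicomputable functions. -/
abbrev LowerSemicomputable {α : Type*} [Primcodable α] (f : α → ℝ) : Prop :=
  SigmaComputable 1 f

/-- Limit computable functions. -/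
abbrev LimitComputable {α : Type*} [Primcodable α] (f : α → ℝ) : Prop :=
  DeltaComputable 2 f

/-! ### Monotone Turing machines -/

/-- What a monotone machine does in one step: change the state, overwrite the scanned cell of each
work tape and move its head by at most one cell, and possibly append one symbol to the output. -/
structure MonotoneTM.Action (X : Type*) (numStates numSymbols numTapes : ℕ) where
  next : Fin (numStates + 1)
  write : Fin numTapes → Fin (numSymbols + 1)
  move : Fin numTapes → Option Turing.Dir
  out : Option X

/-- A (deterministic) monotone Turing machine with output alphabet `X`: it has a one-way read-only
binary input tape, finitely many two-way work tapes, and a one-way write-only output tape.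
The initial state is `0` and the blank symbol of the work tapes is `0`.
In a state `s` with `reads s = true` the machine consumes the next input bit; the transition
then depends on this bit (`some b`), and otherwise on no input (`none`). The value `none` of the
transition function means that the machine halts. -/
structure MonotoneTM (X : Type*) where
  numStates : ℕ
  numSymbols : ℕ
  numTapes : ℕ
  reads : Fin (numStates + 1) → Bool
  trans : Fin (numStates + 1) → Option Bool → (Fin numTapes → Fin (numSymbols + 1)) →
    Option (MonotoneTM.Action X numStates numSymbols numTapes)

namespace MonotoneTM

variable {X : Type*}

/-- A configuration: the state, the part of the input that has not been read yet, the work tapes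
and the output written so far. -/
structure Cfg (T : MonotoneTM X) where
  state : Fin (T.numStates + 1)
  input : List Bool
  tapes : Fin T.numTapes → Turing.Tape (Fin (T.numSymbols + 1))
  output : List X

/-- The initial configuration on input `p`. -/
def init (T : MonotoneTM X) (p : List Bool) : T.Cfg where
  state := 0
  input := p
  tapes := fun _ => default
  output := []

/-- Move a head by at most one cell. -/
def moveTape {Γ : Type*} [Inhabited Γ] : Option Turing.Dir → Turing.Tape Γ → Turing.Tape Γ
  | none, t => t
  | some d, t => t.move d

/-- Apply the transition for the input symbol `b`; `rest` is the input that then remains unread.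
A machine that halts keeps its configuration. -/
def act (T : MonotoneTM X) (c : T.Cfg) (b : Option Bool) (rest : List Bool) : T.Cfg :=
  match T.trans c.state b (fun i => (c.tapes i).head) with
  | none => c
  | some a =>
    { state := a.next
      input := rest
      tapes := fun i => moveTape (a.move i) ((c.tapes i).write (a.write i))
      output := c.output ++ a.out.toList }

/-- One step. A machine that wants to read beyond the end of the input is stuck forever. -/
def step (T : MonotoneTM X) (c : T.Cfg) : T.Cfg :=
  if T.reads c.state then
    match c.input with
    | [] => c
    | b :: rest => T.act c (some b) rest
  else T.act c none c.input

/-- The output written by `T` on input `p` within `t` steps. -/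
def outputAt (T : MonotoneTM X) (p : List Bool) (t : ℕ) : List X :=
  (T.step^[t] (T.init p)).output

/-- `T.Outputs p x` says `x ⊑ T(p)`: the finite string `x` is a prefix of the finite or infinite
string `T(p)` that `T` writes without reading more than the input `p`. -/
def Outputs (T : MonotoneTM X) (p : List Bool) (x : List X) : Prop :=
  ∃ t, x <+: T.outputAt p t

/-- `U` is universal: for each monotone machine `T` there is a string `c` such that
`U(cp) = T(p)` for all `p`. -/
def IsUniversal (U : MonotoneTM X) : Prop :=
  ∀ T : MonotoneTM X, ∃ c : List Bool, ∀ (p : List Bool) (x : List X),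
    U.Outputs (c ++ p) x ↔ T.Outputs p x

/-- `p` is a minimal program for `x`: `x ⊑ T(p)`, but not `x ⊑ T(q)` for a proper prefix `q`
of `p`. -/
def IsMinimalProgram (T : MonotoneTM X) (x : List X) (p : List Bool) : Prop :=
  T.Outputs p x ∧ ∀ q, q <+: p → T.Outputs q x → q = p

end MonotoneTM

/-! ### Solomonoff's prior and its variants -/

/-- Solomonoff's prior `M` for the reference machine `U`: the sum of `2 ^ (-|p|)` over the minimal
programs for `x`, that is, the probability that `U` outputs a string starting with `x` when fed
with uniformly random bits. -/
noncomputable def solomonoffM {X : Type*} (U : MonotoneTM X) (x : List X) : ℝ :=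
  ∑' p : {p : List Bool // U.IsMinimalProgram x p}, (2 : ℝ)⁻¹ ^ p.1.length

/-- Solomonoff normalization of `ν`: the product over `i < |x|` of
`ν (x₁ … xᵢ₊₁) / ∑ b, ν (x₁ … xᵢ b)`. -/
noncomputable def solomonoffNorm {X : Type*} [Fintype X] (ν : List X → ℝ) (x : List X) : ℝ :=
  ∏ i ∈ Finset.range x.length, ν (x.take (i + 1)) / ∑ b, ν (x.take i ++ [b])

theorem solomonoffNorm_nil {X : Type*} [Fintype X] (ν : List X → ℝ) :
    solomonoffNorm ν [] = 1 := by
  simp [solomonoffNorm]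

theorem solomonoffNorm_concat {X : Type*} [Fintype X] (ν : List X → ℝ) (x : List X) (a : X) :
    solomonoffNorm ν (x ++ [a]) = solomonoffNorm ν x * (ν (x ++ [a]) / ∑ b, ν (x ++ [b])) := by
  unfold solomonoffNorm
  rw [List.length_append, List.length_singleton, Finset.prod_range_succ]
  congr 1
  · refine Finset.prod_congr rfl fun i hi => ?_
    have hi : i < x.length := Finset.mem_range.1 hi
    rw [List.take_append_of_le_length (by omega), List.take_append_of_le_length (by omega)]
  · rw [List.take_of_length_le (by simp), List.take_left]

/-- The measure mixture of `ν`: the limit for `n → ∞` of the sum of `ν (xy)` over the strings `y`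
of length `n`. -/
noncomputable def measureMixture {X : Type*} [Fintype X] (ν : List X → ℝ) (x : List X) : ℝ :=
  limUnder atTop fun n : ℕ => ∑ y : Fin n → X, ν (x ++ List.ofFn y)

/-- The conditional `ν (xy | x) = ν (xy) / ν (x)` as a function of the pair `(x, y)`. -/
noncomputable def conditional {X : Type*} (ν : List X → ℝ) (p : List X × List X) : ℝ :=
  ν (p.1 ++ p.2) / ν p.1

/-!
Feed the machine `U` with the `2 ^ t` programs of length `t`, run each of them for `t` steps, and
let `programFreq U x n t` be the proportion of those that have written `x` and at least `n` further
symbols. This is a rational number that a primitive recursive procedure computes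
(`MonotoneTM.primrec_outputAt`, `primrec_card_goodPrograms`), since the run of a machine can be
followed on finite codes of its tapes. Everything else is a limit of these numbers.

The frequency increases with `t`, because a longer program run for longer only writes more. Its
limit `extensionProb U x n` is the sum of `M (xy)` over the strings `y` of length `n`
(`extensionProb_eq_sum`). For `n = 0` this is `M x` (`isLUB_programFreq`): the minimal programs for
`x` are prefix-free, and every program that writes `x` extends exactly one of them, so that the
sum of `2 ^ (-|p|)` and the frequencies bound each other. The limit decreases with `n`, and tends to
the measure mixture (`tendsto_extensionProb`). Thus `M` is a supremum of computable rationals, which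
gives lower semicomputability, and the mixture is an infimum of suprema, which gives `Π⁰₂`.

Conditionals and normalizations are quotients and products of these quantities. Sums over the next
symbol need no separate treatment, because summing over `b` the frequency for `xb` and `n` gives the
frequency for `x` and `n + 1` (`sum_programFreq_concat`). The quotients are continuous since no
denominator vanishes: a universal machine simulates the machine that writes `x` and then repeats a
symbol forever, so that the probabilities for `x` are bounded below uniformly in `n`
(`exists_pos_le_extensionProb`). Hence the functions built from `M` are limits of computable
sequences of rationals, and those built from the mixture are iterated limits; such limits are `Δ⁰₂`
(`DeltaComputable.of_tendsto`) and `Δ⁰₃` (`DeltaComputable.of_tendsto_of_tendsto`). All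
approximations are quotients of natural numbers, so that of the arithmetic of the rationals only
negation and comparisons have to be shown primitive recursive.
-/

/-! ### Monotone machines run primitive recursively -/

/-- A move of a head is coded by a Boolean. -/
instance Turing.Dir.instPrimcodable : Primcodable Turing.Dir :=
  Primcodable.ofEquiv Bool
    { toFun := fun d => match d with
        | .left => false
        | .right => true
      invFun := fun b => match b with
        | false => .left
        | true => .right
      left_inv := by rintro (_ | _) <;> rfl
      right_inv := by rintro (_ | _) <;> rfl }

namespace MonotoneTM

/-- A finitely supported tape as data: the scanned symbol, the cells to its left and the cells to
its right, both read outwards from the head. Trailing blanks may be left out. -/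
abbrev TapeCode (Γ : Type*) := Γ × List Γ × List Γ

/-- The tape that a code stands for. -/
def TapeCode.toTape {Γ : Type*} [Inhabited Γ] (c : TapeCode Γ) : Turing.Tape Γ :=
  ⟨c.1, Turing.ListBlank.mk c.2.1, Turing.ListBlank.mk c.2.2⟩

/-- Write `w` and then move by `m`, on codes of tapes. -/
def TapeCode.update {Γ : Type*} [Inhabited Γ] (w : Γ) (m : Option Turing.Dir) (c : TapeCode Γ) :
    TapeCode Γ :=
  if m = none then (w, c.2.1, c.2.2)
  else if m = some .left then (c.2.1.headI, c.2.1.tail, w :: c.2.2)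
  else (c.2.2.headI, w :: c.2.1, c.2.2.tail)

theorem TapeCode.toTape_update {Γ : Type*} [Inhabited Γ] (w : Γ) (m : Option Turing.Dir)
    (c : TapeCode Γ) : (c.update w m).toTape = moveTape m (c.toTape.write w) := by
  rcases m with _ | _ | _ <;>
    simp [TapeCode.update, TapeCode.toTape, moveTape, Turing.Tape.write, Turing.Tape.move]

theorem TapeCode.primrec_update {Γ α : Type*} [Inhabited Γ] [Primcodable Γ] [Primcodable α]
    {w : α → Γ} {m : α → Option Turing.Dir} {c : α → TapeCode Γ}
    (hw : Primrec w) (hm : Primrec m) (hc : Primrec c) :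
    Primrec fun a => (c a).update (w a) (m a) := by
  have hL : Primrec fun a => (c a).2.1 := Primrec.fst.comp (Primrec.snd.comp hc)
  have hR : Primrec fun a => (c a).2.2 := Primrec.snd.comp (Primrec.snd.comp hc)
  refine Primrec.ite (Primrec.eq.comp hm (Primrec.const _)) (hw.pair (hL.pair hR)) ?_
  refine Primrec.ite (Primrec.eq.comp hm (Primrec.const _)) ?_ ?_
  · exact (Primrec.list_headI.comp hL).pair
      ((Primrec.list_tail.comp hL).pair (Primrec.list_cons.comp hw hR))
  · exact (Primrec.list_headI.comp hR).pair
      ((Primrec.list_cons.comp hw hL).pair (Primrec.list_tail.comp hR))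

variable {X : Type*}

/-- A configuration as data: state, unread input, tapes and output. -/
abbrev CfgCode (T : MonotoneTM X) :=
  Fin (T.numStates + 1) × List Bool × (Fin T.numTapes → TapeCode (Fin (T.numSymbols + 1))) × List X

/-- The configuration that a code stands for. -/
def CfgCode.toCfg {T : MonotoneTM X} (c : T.CfgCode) : T.Cfg :=
  ⟨c.1, c.2.1, fun i => (c.2.2.1 i).toTape, c.2.2.2⟩

/-- The transition table, with actions taken apart into their components. -/
def table (T : MonotoneTM X)
    (k : Fin (T.numStates + 1) × Option Bool × (Fin T.numTapes → Fin (T.numSymbols + 1))) :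
    Option (Fin (T.numStates + 1) × (Fin T.numTapes → Fin (T.numSymbols + 1)) ×
      (Fin T.numTapes → Option Turing.Dir) × Option X) :=
  (T.trans k.1 k.2.1 k.2.2).map fun a => (a.next, a.write, a.move, a.out)

/-- `MonotoneTM.step` on codes of configurations. -/
def stepCode (T : MonotoneTM X) (c : T.CfgCode) : T.CfgCode :=
  if T.reads c.1 = true ∧ c.2.1 = [] then c
  else Option.casesOn (T.table (c.1, (if T.reads c.1 = true then c.2.1.head? else none),
      fun i => (c.2.2.1 i).1)) c
    fun a => (a.1, (if T.reads c.1 = true then c.2.1.tail else c.2.1),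
      (fun i => (c.2.2.1 i).update (a.2.1 i) (a.2.2.1 i)), c.2.2.2 ++ a.2.2.2.toList)

theorem toCfg_stepCode (T : MonotoneTM X) (c : T.CfgCode) :
    (T.stepCode c).toCfg = T.step c.toCfg := by
  obtain ⟨s, p, t, o⟩ := c
  have hd : (fun i => ((t i).toTape).head) = fun i => (t i).1 := rfl
  unfold stepCode step act table
  rcases hr : T.reads s with _ | _
  · simp only [CfgCode.toCfg, hr, hd]
    rcases ht : T.trans s none fun i => (t i).1 with _ | a
    · simp [ht]
    · simp [ht, TapeCode.toTape_update]
  · rcases p with _ | ⟨b, p⟩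
    · simp [CfgCode.toCfg, hr]
    · simp only [CfgCode.toCfg, hr, hd]
      rcases ht : T.trans s (some b) fun i => (t i).1 with _ | a
      · simp [ht]
      · simp [ht, TapeCode.toTape_update]

variable [Primcodable X]

theorem primrec_stepCode (T : MonotoneTM X) : Primrec T.stepCode := by
  have hs : Primrec fun c : T.CfgCode => c.1 := Primrec.fst
  have hp : Primrec fun c : T.CfgCode => c.2.1 := Primrec.fst.comp Primrec.snd
  have ht : Primrec fun c : T.CfgCode => c.2.2.1 :=
    Primrec.fst.comp (Primrec.snd.comp Primrec.snd)
  have ho : Primrec fun c : T.CfgCode => c.2.2.2 :=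
    Primrec.snd.comp (Primrec.snd.comp Primrec.snd)
  have hr : PrimrecPred fun c : T.CfgCode => T.reads c.1 = true :=
    Primrec.eq.comp ((Primrec.dom_finite T.reads).comp hs) (Primrec.const true)
  have hti : ∀ i, Primrec fun c : T.CfgCode => c.2.2.1 i := fun i =>
    Primrec.fin_app.comp ht (Primrec.const i)
  have hh : Primrec fun c : T.CfgCode => fun i => (c.2.2.1 i).1 :=
    Primrec.fin_curry.2 (Primrec₂.swap
      (Primrec.fin_curry₁.2 fun i => Primrec.fst.comp (hti i)))
  refine Primrec.ite (hr.and (Primrec.eq.comp hp (Primrec.const []))) Primrec.id ?_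
  refine Primrec.option_casesOn ((Primrec.dom_finite T.table).comp (hs.pair
    ((Primrec.ite hr (Primrec.list_head?.comp hp) (Primrec.const none)).pair hh))) Primrec.id ?_
  have h1 := @Primrec.fst T.CfgCode (Fin (T.numStates + 1) ×
    (Fin T.numTapes → Fin (T.numSymbols + 1)) × (Fin T.numTapes → Option Turing.Dir) × Option X)
    _ _
  have h2 := @Primrec.snd T.CfgCode (Fin (T.numStates + 1) ×
    (Fin T.numTapes → Fin (T.numSymbols + 1)) × (Fin T.numTapes → Option Turing.Dir) × Option X)
    _ _
  have h22 := Primrec.snd.comp h2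
  have h222 := Primrec.snd.comp h22
  refine Primrec.pair (Primrec.fst.comp h2) (Primrec.pair
    ((Primrec.ite hr (Primrec.list_tail.comp hp) hp).comp h1) (Primrec.pair ?_ ?_))
  · refine Primrec.fin_curry.2 (Primrec₂.swap (Primrec.fin_curry₁.2 fun i => ?_))
    exact TapeCode.primrec_update
      (Primrec.fin_app.comp (Primrec.fst.comp h22) (Primrec.const i))
      (Primrec.fin_app.comp (Primrec.fst.comp h222) (Primrec.const i)) ((hti i).comp h1)
  · exact Primrec.list_append.comp (ho.comp h1) (Primrec.optionToList.comp (Primrec.snd.comp h222))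

/-- What a monotone machine has written is a primitive recursive function of its program and of the
number of steps. -/
theorem primrec_outputAt (T : MonotoneTM X) : Primrec₂ T.outputAt := by
  let start : List Bool → T.CfgCode := fun p => (0, p, fun _ => (default, [], []), [])
  have hstart : Primrec start := (Primrec.const _).pair (Primrec.id.pair (Primrec.const _))
  have hsim : ∀ p t, (T.stepCode^[t] (start p)).toCfg = T.step^[t] (T.init p) := by
    intro p t
    have h0 : (start p).toCfg = T.init p := rfl
    rw [← h0]
    exact Function.Semiconj.iterate_right (f := CfgCode.toCfg)
      (fun c => T.toCfg_stepCode c) t (start p)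
  have hrun : Primrec fun a : List Bool × ℕ => T.stepCode^[a.2] (start a.1) :=
    Primrec.nat_iterate Primrec.snd (hstart.comp Primrec.fst)
      ((T.primrec_stepCode.comp Primrec.snd).to₂)
  refine (Primrec.snd.comp (Primrec.snd.comp (Primrec.snd.comp hrun))).of_eq fun a => ?_
  rw [outputAt, ← hsim]
  rfl

end MonotoneTM

/-! ### The output is monotone in the program and in time -/

namespace MonotoneTM

variable {X : Type*}

theorem output_prefix_output_step (T : MonotoneTM X) (c : T.Cfg) :
    c.output <+: (T.step c).output := by
  have hact : ∀ b rest, c.output <+: (T.act c b rest).output := by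
    intro b rest
    unfold act
    split
    · exact List.prefix_rfl
    · exact List.prefix_append _ _
  unfold step
  split
  · split
    · exact List.prefix_rfl
    · exact hact _ _
  · exact hact _ _

theorem output_prefix_output_iterate (T : MonotoneTM X) (c : T.Cfg) (t : ℕ) :
    c.output <+: (T.step^[t] c).output := by
  induction t with
  | zero => exact List.prefix_rfl
  | succ t ih =>
    rw [Function.iterate_succ_apply']
    exact ih.trans (T.output_prefix_output_step _)

/-- Additional input does not change a run before the run asks for it. -/
theorem output_iterate_prefix_append_input (T : MonotoneTM X) (q : List Bool) (t : ℕ) (c : T.Cfg) :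
    (T.step^[t] c).output <+: (T.step^[t] { c with input := c.input ++ q }).output := by
  induction t generalizing c with
  | zero => exact List.prefix_rfl
  | succ t ih =>
    by_cases hstuck : T.reads c.state = true ∧ c.input = []
    · have hc : Function.IsFixedPt T.step c := by
        simp [Function.IsFixedPt, step, hstuck.1, hstuck.2]
      rw [hc.iterate]
      exact T.output_prefix_output_iterate { c with input := c.input ++ q } _
    · have hstep : T.step { c with input := c.input ++ q } =
          { T.step c with input := (T.step c).input ++ q } := by
        obtain ⟨s, p, w, o⟩ := c
        unfold step act
        rcases hr : T.reads s with _ | _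
        · rcases ht : T.trans s none fun i => (w i).head with _ | a <;> rfl
        · rcases p with _ | ⟨b, p⟩
          · exact absurd ⟨hr, rfl⟩ hstuck
          · rcases ht : T.trans s (some b) fun i => (w i).head with _ | a <;>
              simp only [List.cons_append, ht] <;> rfl
      rw [Function.iterate_succ_apply, Function.iterate_succ_apply, hstep]
      exact ih _

theorem outputAt_prefix_outputAt (T : MonotoneTM X) {p p' : List Bool} {t t' : ℕ}
    (hp : p <+: p') (ht : t ≤ t') : T.outputAt p t <+: T.outputAt p' t' := by
  obtain ⟨q, rfl⟩ := hp
  refine (T.output_iterate_prefix_append_input q t (T.init p)).trans ?_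
  obtain ⟨s, rfl⟩ := Nat.exists_eq_add_of_le' ht
  rw [outputAt, Function.iterate_add_apply]
  exact T.output_prefix_output_iterate _ _

/-! ### Every string has an infinite computable continuation -/

/-- The machine that ignores its input and writes `x` followed by `a` forever. State `i < |x|` writes
the symbol `x i`, and state `|x|` writes `a`. -/
def writeThenRepeat (x : List X) (a : X) : MonotoneTM X where
  numStates := x.length
  numSymbols := 0
  numTapes := 0
  reads := fun _ => false
  trans := fun s _ _ => some
    { next := ⟨min (s + 1) x.length, Nat.lt_succ_of_le (min_le_right _ _)⟩
      write := fun i => i.elim0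
      move := fun i => i.elim0
      out := some (x.getD s a) }

theorem writeThenRepeat_outputs (x : List X) (a : X) (n : ℕ) :
    (writeThenRepeat x a).Outputs [] (x ++ List.replicate n a) := by
  set T := writeThenRepeat x a with hT
  have key : ∀ t, ((T.step^[t] (T.init [])).state : ℕ) = min t x.length ∧
      (T.step^[t] (T.init [])).output = (List.range t).map (x.getD · a) := by
    intro t
    induction t with
    | zero => simp [init]
    | succ t ih =>
      rw [Function.iterate_succ_apply']
      obtain ⟨h1, h2⟩ := ih
      generalize T.step^[t] (T.init []) = c at h1 h2
      have hstep : T.step c = T.act c none c.input := rfl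
      have hs : ((T.step c).state : ℕ) = min ((c.state : ℕ) + 1) x.length := rfl
      have ho : (T.step c).output = c.output ++ [x.getD c.state a] := rfl
      refine ⟨by rw [hs, h1]; omega, ?_⟩
      rw [ho, h2, List.range_succ, List.map_append, h1]
      congr 1
      rcases le_total t x.length with h | h
      · simp [min_eq_left h]
      · simp [h]
  refine ⟨x.length + n, ?_⟩
  rw [outputAt, (key _).2]
  have hlist : (List.range (x.length + n)).map (x.getD · a) = x ++ List.replicate n a := by
    refine List.ext_getElem (by simp) fun i _ _ => ?_
    simp only [List.getElem_map, List.getElem_range, List.getElem_append, List.getElem_replicate]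
    split
    · simp [*]
    · simp [not_lt.1 ‹_›]
  rw [hlist]

end MonotoneTM

/-! ### Counting programs of a given length -/

/-- The bit strings of length `t`. -/
def bitStrings : ℕ → List (List Bool)
  | 0 => [[]]
  | t + 1 => (bitStrings t).flatMap fun p => [false :: p, true :: p]

theorem mem_bitStrings {t : ℕ} {p : List Bool} : p ∈ bitStrings t ↔ p.length = t := by
  induction t generalizing p with
  | zero => simp [bitStrings]
  | succ t ih =>
    rcases p with _ | ⟨_ | _, p⟩ <;> simp [bitStrings, ih]

theorem nodup_bitStrings (t : ℕ) : (bitStrings t).Nodup := by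
  induction t with
  | zero => simp [bitStrings]
  | succ t ih =>
    rw [bitStrings, List.nodup_flatMap]
    refine ⟨fun p _ => by simp, ih.imp fun {p q} hpq => ?_⟩
    simp [Function.onFun, hpq, List.Disjoint]

theorem length_bitStrings (t : ℕ) : (bitStrings t).length = 2 ^ t := by
  induction t with
  | zero => rfl
  | succ t ih => simp [bitStrings, List.length_flatMap, ih, pow_succ]

/-- Counts the strings of length `t` that extend a string from the prefix-free set `S`. A string `q`
that is longer than `t` counts once, by truncated subtraction. -/
theorem card_extensions (S : Finset (List Bool)) (t : ℕ)
    (hfree : ∀ q ∈ S, ∀ r ∈ S, q <+: r → q = r) :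
    (S.biUnion fun q => (bitStrings (t - q.length)).toFinset.image (q ++ ·)).card =
      ∑ q ∈ S, 2 ^ (t - q.length) := by
  rw [Finset.card_biUnion]
  · refine Finset.sum_congr rfl fun q _ => ?_
    rw [Finset.card_image_of_injective _ (List.append_right_injective q),
      List.toFinset_card_of_nodup (nodup_bitStrings _), length_bitStrings]
  · intro q hq r hr hqr
    refine Finset.disjoint_left.2 fun p hp hp' => hqr ?_
    obtain ⟨u, _, rfl⟩ := Finset.mem_image.1 hp
    obtain ⟨v, _, hv⟩ := Finset.mem_image.1 hp'
    rcases List.prefix_or_prefix_of_prefix (List.prefix_append q u)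
      (hv ▸ List.prefix_append r v) with h | h
    · exact hfree q hq r hr h
    · exact (hfree r hr q hq h).symm

open Classical in
/-- The programs of length `t` that have written, after `t` steps, the string `x` and at least `n`
further symbols. -/
noncomputable def goodPrograms {X : Type*} (U : MonotoneTM X) (x : List X) (n t : ℕ) :
    Finset (List Bool) :=
  (bitStrings t).toFinset.filter fun p =>
    x <+: U.outputAt p t ∧ x.length + n ≤ (U.outputAt p t).length

section Counting

variable {X : Type*} {U : MonotoneTM X} {x : List X} {n t : ℕ}

theorem mem_goodPrograms {p : List Bool} : p ∈ goodPrograms U x n t ↔ p.length = t ∧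
    x <+: U.outputAt p t ∧ x.length + n ≤ (U.outputAt p t).length := by
  simp [goodPrograms, mem_bitStrings]

/-- The proportion of the programs of length `t` that have written, after `t` steps, the string `x`
and at least `n` further symbols. -/
noncomputable def programFreq {X : Type*} (U : MonotoneTM X) (x : List X) (n t : ℕ) : ℝ :=
  (goodPrograms U x n t).card / 2 ^ t

theorem programFreq_nonneg : 0 ≤ programFreq U x n t := by
  unfold programFreq
  positivity

theorem inv_two_pow_eq_div {l : ℕ} (h : l ≤ t) : (2 : ℝ)⁻¹ ^ l = 2 ^ (t - l) / 2 ^ t := by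
  obtain ⟨s, rfl⟩ := Nat.exists_eq_add_of_le' h
  rw [Nat.add_sub_cancel, pow_add]
  field_simp
  rw [← mul_pow]
  norm_num

/-- All extensions to length `t` of a program that has written enough have written enough. -/
theorem sum_le_programFreq (S : Finset (List Bool))
    (hfree : ∀ q ∈ S, ∀ r ∈ S, q <+: r → q = r)
    (hS : ∀ q ∈ S, q.length ≤ t ∧ x <+: U.outputAt q t ∧
      x.length + n ≤ (U.outputAt q t).length) :
    ∑ q ∈ S, (2 : ℝ)⁻¹ ^ q.length ≤ programFreq U x n t := by
  rw [Finset.sum_congr rfl fun q hq => inv_two_pow_eq_div (hS q hq).1, ← Finset.sum_div]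
  refine div_le_div_of_nonneg_right ?_ (by positivity)
  have hcard := card_extensions S t hfree
  have hsub : (S.biUnion fun q => (bitStrings (t - q.length)).toFinset.image (q ++ ·)) ⊆
      goodPrograms U x n t := by
    intro p hp
    obtain ⟨q, hq, hp⟩ := Finset.mem_biUnion.1 hp
    obtain ⟨r, hr, rfl⟩ := Finset.mem_image.1 hp
    rw [List.mem_toFinset, mem_bitStrings] at hr
    obtain ⟨h1, h2, h3⟩ := hS q hq
    have hpre := U.outputAt_prefix_outputAt (List.prefix_append q r) (le_refl t)
    exact mem_goodPrograms.2 ⟨by simp [hr, h1], h2.trans hpre, h3.trans hpre.length_le⟩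
  exact_mod_cast hcard ▸ Finset.card_le_card hsub

/-- Kraft's count from above: the programs of length `t` that write enough are covered by the
extensions of the strings in `S`. -/
theorem programFreq_le_sum (S : Finset (List Bool))
    (hfree : ∀ q ∈ S, ∀ r ∈ S, q <+: r → q = r) (hlen : ∀ q ∈ S, q.length ≤ t)
    (hS : ∀ p ∈ goodPrograms U x n t, ∃ q ∈ S, q <+: p) :
    programFreq U x n t ≤ ∑ q ∈ S, (2 : ℝ)⁻¹ ^ q.length := by
  rw [Finset.sum_congr rfl fun q hq => inv_two_pow_eq_div (hlen q hq), ← Finset.sum_div]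
  refine div_le_div_of_nonneg_right ?_ (by positivity)
  have hcard := card_extensions S t hfree
  have hsub : goodPrograms U x n t ⊆
      S.biUnion fun q => (bitStrings (t - q.length)).toFinset.image (q ++ ·) := by
    intro p hp
    obtain ⟨q, hq, r, rfl⟩ := hS p hp
    refine Finset.mem_biUnion.2 ⟨q, hq, Finset.mem_image.2 ⟨r, ?_, rfl⟩⟩
    have hl := (mem_goodPrograms.1 hp).1
    rw [List.length_append] at hl
    rw [List.mem_toFinset, mem_bitStrings]
    omega
  exact_mod_cast hcard ▸ Finset.card_le_card hsub

theorem monotone_programFreq : Monotone (programFreq U x n) := by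
  intro s t hst
  have h : programFreq U x n s = ∑ q ∈ goodPrograms U x n s, (2 : ℝ)⁻¹ ^ q.length := by
    rw [Finset.sum_congr rfl fun q hq => by rw [(mem_goodPrograms.1 hq).1], Finset.sum_const,
      nsmul_eq_mul, inv_pow, ← div_eq_mul_inv]
    rfl
  rw [h]
  refine sum_le_programFreq _ (fun q hq r hr hqr => ?_) fun q hq => ?_
  · exact hqr.eq_of_length ((mem_goodPrograms.1 hq).1.trans (mem_goodPrograms.1 hr).1.symm)
  · obtain ⟨h1, h2, h3⟩ := mem_goodPrograms.1 hq
    have hpre := U.outputAt_prefix_outputAt (List.prefix_refl q) hst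
    exact ⟨h1.trans_le hst, h2.trans hpre, h3.trans hpre.length_le⟩

theorem antitone_programFreq : Antitone fun n => programFreq U x n t := by
  intro m n hmn
  refine div_le_div_of_nonneg_right (Nat.cast_le.2 (Finset.card_le_card fun p hp => ?_))
    (by positivity)
  obtain ⟨h1, h2, h3⟩ := mem_goodPrograms.1 hp
  exact mem_goodPrograms.2 ⟨h1, h2, by omega⟩

theorem programFreq_le_one : programFreq U x n t ≤ 1 := by
  refine (programFreq_le_sum {[]} (by simp) (by simp) fun p _ => ⟨[], by simp⟩).trans ?_
  simp

/-- The programs that write `x` and at least one more symbol are sorted by that symbol. -/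
theorem sum_programFreq_concat [Fintype X] :
    ∑ b, programFreq U (x ++ [b]) n t = programFreq U x (n + 1) t := by
  classical
  have hunion : goodPrograms U x (n + 1) t =
      Finset.univ.biUnion fun b => goodPrograms U (x ++ [b]) n t := by
    ext p
    simp only [Finset.mem_biUnion, Finset.mem_univ, true_and, mem_goodPrograms,
      List.length_append, List.length_singleton]
    constructor
    · rintro ⟨h1, ⟨z, hz⟩, h3⟩
      rcases z with _ | ⟨b, z⟩
      · rw [← hz] at h3
        simp at h3
      · exact ⟨b, h1, ⟨z, by simp [← hz]⟩, by omega⟩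
    · rintro ⟨b, h1, h2, h3⟩
      exact ⟨h1, (List.prefix_append x [b]).trans h2, by omega⟩
  unfold programFreq
  rw [← Finset.sum_div, hunion, Finset.card_biUnion]
  · push_cast
    rfl
  · intro b _ c _ hbc
    refine Finset.disjoint_left.2 fun p hb hc => hbc ?_
    have h := List.prefix_of_prefix_length_le (mem_goodPrograms.1 hb).2.1
      (mem_goodPrograms.1 hc).2.1 (by simp)
    simpa using h.eq_of_length (by simp)

/-! ### Solomonoff's prior as a limit of frequencies -/

theorem exists_minimalProgram_prefix {p : List Bool} (h : U.Outputs p x) :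
    ∃ q, U.IsMinimalProgram x q ∧ q <+: p := by
  classical
  have hex : ∃ k, U.Outputs (p.take k) x := ⟨p.length, by simpa using h⟩
  refine ⟨p.take (Nat.find hex), ⟨Nat.find_spec hex, fun q hq hout => ?_⟩, List.take_prefix _ _⟩
  have hqp : q = p.take q.length :=
    List.prefix_iff_eq_take.1 (hq.trans (List.take_prefix _ _))
  have hle : Nat.find hex ≤ q.length := Nat.find_min' hex (hqp ▸ hout)
  exact hq.eq_of_length (le_antisymm hq.length_le ((List.length_take_le _ _).trans hle))

/-- Finitely many minimal programs have all written `x` at some time `t` that exceeds their lengths,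
and their extensions to length `t` are counted by the frequency. -/
theorem sum_minimalPrograms_le (F : Finset {p : List Bool // U.IsMinimalProgram x p}) :
    ∃ t, ∑ p ∈ F, (2 : ℝ)⁻¹ ^ p.1.length ≤ programFreq U x 0 t := by
  classical
  choose τ hτ using fun p : {p : List Bool // U.IsMinimalProgram x p} => p.2.1
  refine ⟨F.sup fun p => max (τ p) p.1.length, ?_⟩
  rw [← Finset.sum_image (s := F) (g := Subtype.val) (f := fun p => (2 : ℝ)⁻¹ ^ p.length)
    Subtype.val_injective.injOn]
  refine sum_le_programFreq _ (fun q hq r hr hqr => ?_) fun q hq => ?_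
  · obtain ⟨q, -, rfl⟩ := Finset.mem_image.1 hq
    obtain ⟨r, -, rfl⟩ := Finset.mem_image.1 hr
    exact r.2.2 _ hqr q.2.1
  · obtain ⟨q, hqF, rfl⟩ := Finset.mem_image.1 hq
    have hle := Finset.le_sup (f := fun p => max (τ p) p.1.length) hqF
    have hpre := (hτ q).trans (U.outputAt_prefix_outputAt (List.prefix_refl q.1)
      ((le_max_left _ _).trans hle))
    exact ⟨(le_max_right _ _).trans hle, hpre, hpre.length_le⟩

theorem summable_minimalPrograms :
    Summable fun p : {p : List Bool // U.IsMinimalProgram x p} => (2 : ℝ)⁻¹ ^ p.1.length :=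
  summable_of_sum_le (c := 1) (fun _ => by positivity) fun F =>
    (sum_minimalPrograms_le F).elim fun _ h => h.trans programFreq_le_one

theorem programFreq_le_solomonoffM : programFreq U x 0 t ≤ solomonoffM U x := by
  classical
  let S : Finset (List Bool) := ((Finset.range (t + 1)).biUnion
    fun l => (bitStrings l).toFinset).filter fun p => U.IsMinimalProgram x p
  have hS : ∀ q, q ∈ S ↔ q.length ≤ t ∧ U.IsMinimalProgram x q := by
    intro q
    simp [S, mem_bitStrings]
  refine (programFreq_le_sum S (fun q hq r hr hqr => ?_) (fun q hq => ((hS q).1 hq).1)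
    fun p hp => ?_).trans ?_
  · exact ((hS r).1 hr).2.2 _ hqr ((hS q).1 hq).2.1
  · obtain ⟨h1, h2, -⟩ := mem_goodPrograms.1 hp
    obtain ⟨q, hq, hqp⟩ := exists_minimalProgram_prefix (U := U) (x := x) ⟨t, h2⟩
    exact ⟨q, (hS q).2 ⟨h1 ▸ hqp.length_le, hq⟩, hqp⟩
  · rw [← Finset.sum_subtype_of_mem (p := fun p => U.IsMinimalProgram x p)
      (fun q : List Bool => (2 : ℝ)⁻¹ ^ q.length) fun q hq => ((hS q).1 hq).2]
    exact summable_minimalPrograms.sum_le_tsum _ fun _ _ => by positivity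

/-- Solomonoff's prior is the increasing limit of the proportion of programs of length `t` that
write `x` within `t` steps. -/
theorem isLUB_programFreq : IsLUB (Set.range (programFreq U x 0)) (solomonoffM U x) := by
  refine ⟨?_, fun b hb => ?_⟩
  · rintro _ ⟨t, rfl⟩
    exact programFreq_le_solomonoffM
  · refine summable_minimalPrograms.tsum_le_of_sum_le fun F => ?_
    obtain ⟨t, ht⟩ := sum_minimalPrograms_le F
    exact ht.trans (hb ⟨t, rfl⟩)

end Counting

/-! ### Positivity and limits -/

/-- The probability that `U`, fed with uniformly random bits, writes `x` and at least `n` further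
symbols; see `extensionProb_eq_sum`. -/
noncomputable def extensionProb {X : Type*} (U : MonotoneTM X) (x : List X) (n : ℕ) : ℝ :=
  ⨆ t, programFreq U x n t

section Limits

variable {X : Type*} {U : MonotoneTM X}

theorem bddAbove_range_programFreq (x : List X) (n : ℕ) :
    BddAbove (Set.range (programFreq U x n)) :=
  ⟨1, by rintro _ ⟨t, rfl⟩; exact programFreq_le_one⟩

theorem programFreq_le_extensionProb (x : List X) (n t : ℕ) :
    programFreq U x n t ≤ extensionProb U x n :=
  le_ciSup (bddAbove_range_programFreq x n) t

theorem extensionProb_nonneg (x : List X) (n : ℕ) : 0 ≤ extensionProb U x n :=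
  programFreq_nonneg.trans (programFreq_le_extensionProb x n 0)

theorem tendsto_programFreq (x : List X) (n : ℕ) :
    Tendsto (programFreq U x n) atTop (𝓝 (extensionProb U x n)) :=
  tendsto_atTop_ciSup monotone_programFreq (bddAbove_range_programFreq x n)

theorem extensionProb_zero (x : List X) : extensionProb U x 0 = solomonoffM U x :=
  isLUB_programFreq.csSup_eq (Set.range_nonempty _)

theorem antitone_extensionProb (x : List X) : Antitone (extensionProb U x) := fun _ _ h =>
  ciSup_mono (bddAbove_range_programFreq x _) fun t => antitone_programFreq (t := t) h

/-- A universal machine has a program that writes `x` and never stops writing after that, so that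
the probabilities of the extensions of `x` are bounded away from `0`. -/
theorem exists_pos_le_extensionProb [Nonempty X] (hU : U.IsUniversal) (x : List X) :
    ∃ ε > 0, ∀ n, ε ≤ extensionProb U x n := by
  obtain ⟨a⟩ := ‹Nonempty X›
  obtain ⟨c, hc⟩ := hU (MonotoneTM.writeThenRepeat x a)
  refine ⟨(2 : ℝ)⁻¹ ^ c.length, by positivity, fun n => ?_⟩
  obtain ⟨t, ht⟩ := (hc [] _).2 (MonotoneTM.writeThenRepeat_outputs x a n)
  rw [List.append_nil] at ht
  have hpre := ht.trans (U.outputAt_prefix_outputAt (List.prefix_refl c) (le_max_left t c.length))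
  refine le_trans ?_ (programFreq_le_extensionProb x n (max t c.length))
  rw [← Finset.sum_singleton (fun q : List Bool => (2 : ℝ)⁻¹ ^ q.length) c]
  refine sum_le_programFreq {c} (by simp) fun q hq => ?_
  rw [Finset.mem_singleton.1 hq]
  exact ⟨le_max_right _ _, (List.prefix_append _ _).trans hpre, by simpa using hpre.length_le⟩

theorem extensionProb_pos [Nonempty X] (hU : U.IsUniversal) (x : List X) (n : ℕ) :
    0 < extensionProb U x n :=
  (exists_pos_le_extensionProb hU x).elim fun _ h => h.1.trans_le (h.2 n)

/-- The products of ratios of frequencies that approximate the normalizations of `M` (for `n = 0`)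
and of the measure mixture (for `n → ∞`). -/
theorem tendsto_prod_programFreq [Nonempty X] (hU : U.IsUniversal) (x : List X) (n : ℕ) :
    Tendsto (fun t => ∏ i ∈ Finset.range x.length,
        programFreq U (x.take (i + 1)) n t / programFreq U (x.take i) (n + 1) t) atTop
      (𝓝 (∏ i ∈ Finset.range x.length,
        extensionProb U (x.take (i + 1)) n / extensionProb U (x.take i) (n + 1))) :=
  tendsto_finsetProd _ fun _ _ => (tendsto_programFreq _ _).div (tendsto_programFreq _ _)
    (extensionProb_pos hU _ _).ne'

variable [Fintype X]

theorem sum_extensionProb_concat (x : List X) (n : ℕ) :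
    ∑ b, extensionProb U (x ++ [b]) n = extensionProb U x (n + 1) := by
  refine tendsto_nhds_unique (tendsto_finsetSum _ fun b _ => tendsto_programFreq (x ++ [b]) n) ?_
  simp_rw [sum_programFreq_concat]
  exact tendsto_programFreq x (n + 1)

theorem extensionProb_eq_sum (x : List X) (n : ℕ) :
    extensionProb U x n = ∑ y : Fin n → X, solomonoffM U (x ++ List.ofFn y) := by
  induction n generalizing x with
  | zero => simp [extensionProb_zero]
  | succ n ih =>
    rw [← sum_extensionProb_concat, ← (Fin.consEquiv fun _ : Fin (n + 1) => X).sum_comp,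
      Fintype.sum_prod_type]
    refine Finset.sum_congr rfl fun b _ => ?_
    rw [ih]
    refine Finset.sum_congr rfl fun y _ => ?_
    simp [Fin.consEquiv, List.ofFn_succ]

theorem tendsto_extensionProb (x : List X) :
    Tendsto (extensionProb U x) atTop (𝓝 (measureMixture (solomonoffM U) x)) := by
  have h : Tendsto (extensionProb U x) atTop (𝓝 (⨅ n, extensionProb U x n)) :=
    tendsto_atTop_ciInf (antitone_extensionProb x)
      ⟨0, by rintro _ ⟨n, rfl⟩; exact extensionProb_nonneg x n⟩
  have heq : measureMixture (solomonoffM U) x = ⨅ n, extensionProb U x n := by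
    unfold measureMixture
    simp_rw [← extensionProb_eq_sum]
    exact h.limUnder_eq
  rwa [heq]

theorem measureMixture_le_extensionProb (x : List X) (n : ℕ) :
    measureMixture (solomonoffM U) x ≤ extensionProb U x n :=
  (antitone_extensionProb x).le_of_tendsto (tendsto_extensionProb x) n

theorem measureMixture_pos [Nonempty X] (hU : U.IsUniversal) (x : List X) :
    0 < measureMixture (solomonoffM U) x := by
  obtain ⟨ε, hε, h⟩ := exists_pos_le_extensionProb hU x
  exact hε.trans_le (ge_of_tendsto' (tendsto_extensionProb x) h)

theorem sum_measureMixture_concat (x : List X) :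
    ∑ b, measureMixture (solomonoffM U) (x ++ [b]) = measureMixture (solomonoffM U) x := by
  refine tendsto_nhds_unique (tendsto_finsetSum _ fun b _ => tendsto_extensionProb (x ++ [b])) ?_
  simp_rw [sum_extensionProb_concat]
  exact (tendsto_add_atTop_iff_nat 1).2 (tendsto_extensionProb x)

theorem solomonoffNorm_solomonoffM (x : List X) :
    solomonoffNorm (solomonoffM U) x = ∏ i ∈ Finset.range x.length,
      extensionProb U (x.take (i + 1)) 0 / extensionProb U (x.take i) (0 + 1) := by
  simp_rw [← sum_extensionProb_concat, extensionProb_zero]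
  rfl

theorem tendsto_prod_extensionProb [Nonempty X] (hU : U.IsUniversal) (x : List X) :
    Tendsto (fun n => ∏ i ∈ Finset.range x.length,
        extensionProb U (x.take (i + 1)) n / extensionProb U (x.take i) (n + 1)) atTop
      (𝓝 (solomonoffNorm (measureMixture (solomonoffM U)) x)) := by
  unfold solomonoffNorm
  simp_rw [sum_measureMixture_concat]
  exact tendsto_finsetProd _ fun _ _ => (tendsto_extensionProb _).div
    ((tendsto_add_atTop_iff_nat 1).2 (tendsto_extensionProb _)) (measureMixture_pos hU _).ne'

theorem solomonoffNorm_measureMixture_pos [Nonempty X] (hU : U.IsUniversal) (x : List X) :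
    0 < solomonoffNorm (measureMixture (solomonoffM U)) x := by
  unfold solomonoffNorm
  simp_rw [sum_measureMixture_concat]
  exact Finset.prod_pos fun _ _ => div_pos (measureMixture_pos hU _) (measureMixture_pos hU _)

end Limits

/-! ### Comparison of rational numbers -/

theorem Primrec.nat_pow : Primrec₂ ((· ^ ·) : ℕ → ℕ → ℕ) :=
  Primrec₂.unpaired'.1 Nat.Primrec.pow

theorem Primrec.finset_prod_range {α : Type*} [Primcodable α] {k : α → ℕ} {f : α → ℕ → ℕ}
    (hk : Primrec k) (hf : Primrec₂ f) : Primrec fun a => ∏ i ∈ Finset.range (k a), f a i := by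
  refine (Primrec.nat_rec' (f := k) (g := fun _ => 1) (h := fun a p => p.2 * f a p.1) hk
    (Primrec.const 1) ?_).of_eq fun a => ?_
  · exact Primrec.nat_mul.comp (Primrec.snd.comp Primrec.snd)
      (hf.comp Primrec.fst (Primrec.fst.comp Primrec.snd))
  · generalize k a = m
    induction m with
    | zero => rfl
    | succ m ih => rw [Finset.prod_range_succ, ← ih]

namespace Rat

theorem primrec_intEquivNat_num : Primrec fun q : ℚ => Equiv.intEquivNat q.num :=
  (Primrec.fst.comp (Primrec.unpair.comp Primrec.encode)).of_eq fun q => by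
    change (Nat.unpair (Nat.pair (Equiv.intEquivNat q.num) q.den)).1 = _
    rw [Nat.unpair_pair]

theorem primrec_den : Primrec fun q : ℚ => q.den :=
  (Primrec.snd.comp (Primrec.unpair.comp Primrec.encode)).of_eq fun q => by
    change (Nat.unpair (Nat.pair (Equiv.intEquivNat q.num) q.den)).2 = _
    rw [Nat.unpair_pair]

/-- The nonnegative integer `k` has code `2 * k`. -/
theorem _root_.Int.intEquivNat_natCast (k : ℕ) : Equiv.intEquivNat (k : ℤ) = 2 * k := by
  change Nat.bit false k = _
  simp

/-- The negative integer `-(k + 1)` has code `2 * k + 1`. -/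
theorem _root_.Int.intEquivNat_negSucc (k : ℕ) :
    Equiv.intEquivNat (Int.negSucc k) = 2 * k + 1 := by
  change Nat.bit true k = _
  simp

theorem primrec_num_toNat : Primrec fun q : ℚ => q.num.toNat := by
  refine (Primrec.ite (Primrec.eq.comp (Primrec.nat_mod.comp primrec_intEquivNat_num
    (Primrec.const 2)) (Primrec.const 0)) (Primrec.nat_div.comp primrec_intEquivNat_num
    (Primrec.const 2)) (Primrec.const 0)).of_eq fun q => ?_
  rcases q.num with k | k
  · rw [Int.ofNat_eq_natCast, Int.intEquivNat_natCast, if_pos (by omega)]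
    simp
  · rw [Int.intEquivNat_negSucc, if_neg (by omega)]
    simp

theorem primrec_neg_num_toNat : Primrec fun q : ℚ => (-q.num).toNat := by
  refine (Primrec.ite (Primrec.eq.comp (Primrec.nat_mod.comp primrec_intEquivNat_num
    (Primrec.const 2)) (Primrec.const 0)) (Primrec.const 0) (Primrec.nat_div.comp
    (Primrec.succ.comp primrec_intEquivNat_num) (Primrec.const 2))).of_eq fun q => ?_
  rcases q.num with k | k
  · rw [Int.ofNat_eq_natCast, Int.intEquivNat_natCast, if_pos (by omega)]
    simp
  · rw [Int.intEquivNat_negSucc, if_neg (by omega)]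
    simp
    omega

theorem primrec_neg : Primrec fun q : ℚ => -q := by
  refine Primrec.encode_iff.1 ((Primrec₂.natPair.comp (Primrec.ite (Primrec.eq.comp
    (Primrec.nat_mod.comp primrec_intEquivNat_num (Primrec.const 2)) (Primrec.const 0))
    (Primrec.pred.comp primrec_intEquivNat_num) (Primrec.succ.comp primrec_intEquivNat_num))
    primrec_den).of_eq fun q => ?_)
  change _ = Nat.pair (Equiv.intEquivNat (-q).num) (-q).den
  rw [Rat.neg_num, Rat.neg_den]
  congr 1
  rcases q.num with (_ | k) | k
  · rfl
  · rw [Int.ofNat_eq_natCast, Int.intEquivNat_natCast, if_pos (by omega),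
      show -((k + 1 : ℕ) : ℤ) = Int.negSucc k by omega, Int.intEquivNat_negSucc, Nat.pred_eq_sub_one]
    omega
  · rw [Int.intEquivNat_negSucc, if_neg (by omega), Int.neg_negSucc, Int.intEquivNat_natCast]
    omega

theorem cast_eq_toNat_sub_toNat_div (q : ℚ) :
    (q : ℝ) = ((q.num.toNat : ℝ) - (-q.num).toNat) / q.den := by
  have h : ((q.num.toNat : ℤ) : ℝ) - (((-q.num).toNat : ℤ) : ℝ) = (q.num : ℝ) := by
    rw [← Int.cast_sub, Int.toNat_sub_toNat_neg]
  rw [Int.cast_natCast, Int.cast_natCast] at h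
  rw [h]
  exact Rat.cast_def q

/-- Comparison with a fraction `a / b` by arithmetic in `ℕ`. The case `b = 0`, where `a / b = 0`, is
needed because the approximating fractions may have a vanishing denominator at first. -/
theorem cast_lt_natCast_div_iff (q : ℚ) (a b : ℕ) : (q : ℝ) < (a : ℝ) / b ↔
    (b = 0 ∧ q.num.toNat < (-q.num).toNat) ∨
      (0 < b ∧ q.num.toNat * b < a * q.den + (-q.num).toNat * b) := by
  have hd : (0 : ℝ) < q.den := Nat.cast_pos.2 q.den_pos
  rw [cast_eq_toNat_sub_toNat_div]
  rcases Nat.eq_zero_or_pos b with rfl | hb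
  · rw [Nat.cast_zero, div_zero, div_lt_iff₀ hd]
    simp
  · have hb' : (0 : ℝ) < b := Nat.cast_pos.2 hb
    simp only [hb, hb.ne', false_and, true_and, false_or]
    rw [div_lt_div_iff₀ hd hb', ← Nat.cast_lt (α := ℝ)]
    push_cast
    constructor <;> intro h <;> linarith

theorem natCast_div_lt_cast_iff (q : ℚ) (a b : ℕ) : (a : ℝ) / b < q ↔
    (b = 0 ∧ (-q.num).toNat < q.num.toNat) ∨
      (0 < b ∧ a * q.den + (-q.num).toNat * b < q.num.toNat * b) := by
  have hd : (0 : ℝ) < q.den := Nat.cast_pos.2 q.den_pos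
  rw [cast_eq_toNat_sub_toNat_div]
  rcases Nat.eq_zero_or_pos b with rfl | hb
  · rw [Nat.cast_zero, div_zero, lt_div_iff₀ hd]
    simp
  · have hb' : (0 : ℝ) < b := Nat.cast_pos.2 hb
    simp only [hb, hb.ne', false_and, true_and, false_or]
    rw [div_lt_div_iff₀ hb' hd, ← Nat.cast_lt (α := ℝ)]
    push_cast
    constructor <;> intro h <;> linarith

theorem primrecRel_lt : PrimrecRel fun q r : ℚ => q < r := by
  have h1 := @Primrec.fst ℚ ℚ _ _
  have h2 := @Primrec.snd ℚ ℚ _ _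
  refine (Primrec.nat_lt.comp
    (Primrec.nat_add.comp
      (Primrec.nat_mul.comp (primrec_num_toNat.comp h1) (primrec_den.comp h2))
      (Primrec.nat_mul.comp (primrec_neg_num_toNat.comp h2) (primrec_den.comp h1)))
    (Primrec.nat_add.comp
      (Primrec.nat_mul.comp (primrec_num_toNat.comp h2) (primrec_den.comp h1))
      (Primrec.nat_mul.comp (primrec_neg_num_toNat.comp h1) (primrec_den.comp h2)))).of_eq
    fun p => ?_
  change _ ↔ p.1 < p.2
  rw [← Rat.cast_lt (K := ℝ), cast_eq_toNat_sub_toNat_div p.1, cast_eq_toNat_sub_toNat_div p.2,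
    div_lt_div_iff₀ (Nat.cast_pos.2 p.1.den_pos) (Nat.cast_pos.2 p.2.den_pos), ← Nat.cast_lt (α := ℝ)]
  push_cast
  constructor <;> intro h <;> linarith

end Rat

section Comparison

variable {α : Type*} [Primcodable α] {A B : α → ℕ}

theorem primrecPred_cast_lt_natCast_div (hA : Primrec A) (hB : Primrec B) :
    PrimrecPred fun p : α × ℚ => (p.2 : ℝ) < (A p.1 : ℝ) / B p.1 := by
  have hA := hA.comp (Primrec.fst (α := α) (β := ℚ))
  have hB := hB.comp (Primrec.fst (α := α) (β := ℚ))
  have hP := Rat.primrec_num_toNat.comp (Primrec.snd (α := α) (β := ℚ))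
  have hN := Rat.primrec_neg_num_toNat.comp (Primrec.snd (α := α) (β := ℚ))
  have hD := Rat.primrec_den.comp (Primrec.snd (α := α) (β := ℚ))
  refine PrimrecPred.of_eq (PrimrecPred.or
    ((Primrec.eq.comp hB (Primrec.const 0)).and (Primrec.nat_lt.comp hP hN))
    ((Primrec.nat_lt.comp (Primrec.const 0) hB).and (Primrec.nat_lt.comp
      (Primrec.nat_mul.comp hP hB)
      (Primrec.nat_add.comp (Primrec.nat_mul.comp hA hD) (Primrec.nat_mul.comp hN hB)))))
    fun p => (Rat.cast_lt_natCast_div_iff p.2 _ _).symm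

theorem primrecPred_natCast_div_lt_cast (hA : Primrec A) (hB : Primrec B) :
    PrimrecPred fun p : α × ℚ => (A p.1 : ℝ) / B p.1 < p.2 := by
  have hA := hA.comp (Primrec.fst (α := α) (β := ℚ))
  have hB := hB.comp (Primrec.fst (α := α) (β := ℚ))
  have hP := Rat.primrec_num_toNat.comp (Primrec.snd (α := α) (β := ℚ))
  have hN := Rat.primrec_neg_num_toNat.comp (Primrec.snd (α := α) (β := ℚ))
  have hD := Rat.primrec_den.comp (Primrec.snd (α := α) (β := ℚ))
  refine PrimrecPred.of_eq (PrimrecPred.or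
    ((Primrec.eq.comp hB (Primrec.const 0)).and (Primrec.nat_lt.comp hN hP))
    ((Primrec.nat_lt.comp (Primrec.const 0) hB).and (Primrec.nat_lt.comp
      (Primrec.nat_add.comp (Primrec.nat_mul.comp hA hD) (Primrec.nat_mul.comp hN hB))
      (Primrec.nat_mul.comp hP hB))))
    fun p => (Rat.natCast_div_lt_cast_iff p.2 _ _).symm

end Comparison

/-! ### Quantifier prefixes over coded data -/

/-- The element of `β` with code `k`, or the default element if there is none. -/
def decodeD (β : Type*) [Primcodable β] [Inhabited β] (k : ℕ) : β :=
  (Encodable.decode k : Option β).getD default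

theorem decodeD_surjective (β : Type*) [Primcodable β] [Inhabited β] :
    Function.Surjective (decodeD β) := fun b => ⟨Encodable.encode b, by simp [decodeD]⟩

theorem primrec_decodeD (β : Type*) [Primcodable β] [Inhabited β] : Primrec (decodeD β) :=
  Primrec.option_getD_default.comp Primrec.decode

section Hierarchy

variable {α β γ δ : Type*} [Primcodable α] [Primcodable β] [Primcodable γ] [Primcodable δ]

theorem isSigma_one [Inhabited β] {A : Set α} {P : α → β → Prop} (hP : PrimrecPred fun p : α × β => P p.1 p.2)
    (h : ∀ a, a ∈ A ↔ ∃ b, P a b) : IsSigma 1 A := by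
  refine ⟨fun a v => P a (decodeD β v.head), PrimrecPred.computablePred ?_, fun a => ?_⟩
  · exact hP.comp (Primrec.fst.pair ((primrec_decodeD β).comp
      (Primrec.vector_head.comp Primrec.snd)))
  · rw [h, (decodeD_surjective β).exists]
    rfl

theorem isSigma_two [Inhabited β] [Inhabited γ] {A : Set α} {P : α → β → γ → Prop}
    (hP : PrimrecPred fun p : α × β × γ => P p.1 p.2.1 p.2.2)
    (h : ∀ a, a ∈ A ↔ ∃ b, ∀ c, P a b c) : IsSigma 2 A := by
  refine ⟨fun a v => P a (decodeD β v.head) (decodeD γ v.tail.head),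
    PrimrecPred.computablePred ?_, fun a => ?_⟩
  · exact hP.comp (Primrec.fst.pair (((primrec_decodeD β).comp
      (Primrec.vector_head.comp Primrec.snd)).pair ((primrec_decodeD γ).comp
      (Primrec.vector_head.comp (Primrec.vector_tail.comp Primrec.snd)))))
  · rw [h, (decodeD_surjective β).exists]
    simp_rw [(decodeD_surjective γ).forall]
    rfl

theorem isSigma_three [Inhabited β] [Inhabited γ] [Inhabited δ] {A : Set α} {P : α → β → γ → δ → Prop}
    (hP : PrimrecPred fun p : α × β × γ × δ => P p.1 p.2.1 p.2.2.1 p.2.2.2)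
    (h : ∀ a, a ∈ A ↔ ∃ b, ∀ c, ∃ d, P a b c d) : IsSigma 3 A := by
  refine ⟨fun a v => P a (decodeD β v.head) (decodeD γ v.tail.head) (decodeD δ v.tail.tail.head),
    PrimrecPred.computablePred ?_, fun a => ?_⟩
  · exact hP.comp (Primrec.fst.pair (((primrec_decodeD β).comp
      (Primrec.vector_head.comp Primrec.snd)).pair (((primrec_decodeD γ).comp
      (Primrec.vector_head.comp (Primrec.vector_tail.comp Primrec.snd))).pair
      ((primrec_decodeD δ).comp (Primrec.vector_head.comp (Primrec.vector_tail.comp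
        (Primrec.vector_tail.comp Primrec.snd)))))))
  · rw [h, (decodeD_surjective β).exists]
    simp_rw [(decodeD_surjective γ).forall, (decodeD_surjective δ).exists]
    rfl

theorem IsSigma.preimage {n : ℕ} {A : Set β} (hA : IsSigma n A) {f : α → β} (hf : Primrec f) :
    IsSigma n (f ⁻¹' A) := by
  obtain ⟨S, hS, h⟩ := hA
  refine ⟨fun a => S (f a), ?_, fun a => h (f a)⟩
  exact ComputablePred.computable_of_manyOneReducible
    ⟨fun p : α × List.Vector ℕ n => (f p.1, p.2),
      ((hf.comp Primrec.fst).pair Primrec.snd).to_comp, fun _ => Iff.rfl⟩ hS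

/-! ### Functions that are limits of rational sequences -/

theorem PiComputable.of_neg {n : ℕ} {f : α → ℝ} (h : SigmaComputable n fun a => -f a) :
    PiComputable n f := by
  have heq : {p : α × ℚ | f p.1 ≥ (p.2 : ℝ)}ᶜ =
      (fun p : α × ℚ => (p.1, -p.2)) ⁻¹' {p : α × ℚ | -f p.1 > (p.2 : ℝ)} := by
    ext p
    simp
  unfold PiComputable IsPi
  rw [heq]
  exact IsSigma.preimage h (Primrec.fst.pair (Rat.primrec_neg.comp Primrec.snd))

theorem SigmaComputable.of_tendsto {f : α → ℝ} {g : α × ℕ → ℝ}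
    (hg : PrimrecPred fun p : (α × ℕ) × ℚ => (p.2 : ℝ) < g p.1)
    (h : ∀ a, Tendsto (fun t => g (a, t)) atTop (𝓝 (f a))) : SigmaComputable 2 f := by
  -- `q < f a` iff some rational `r > q` is below all but finitely many terms of the sequence.
  refine isSigma_two (β := ℚ × ℕ) (γ := ℕ)
    (P := fun p b t => p.2 < b.1 ∧ (t < b.2 ∨ (b.1 : ℝ) < g (p.1, t))) ?_ ?_
  · have hr : Primrec fun p : (α × ℚ) × (ℚ × ℕ) × ℕ => p.2.1.1 :=
      Primrec.fst.comp (Primrec.fst.comp Primrec.snd)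
    have ht : Primrec fun p : (α × ℚ) × (ℚ × ℕ) × ℕ => p.2.2 := Primrec.snd.comp Primrec.snd
    refine (Rat.primrecRel_lt.comp (Primrec.snd.comp Primrec.fst) hr).and
      ((Primrec.nat_lt.comp ht (Primrec.snd.comp (Primrec.fst.comp Primrec.snd))).or ?_)
    exact hg.comp (((Primrec.fst.comp Primrec.fst).pair ht).pair hr)
  · rintro ⟨a, q⟩
    simp only [Set.mem_ofPred_eq, gt_iff_lt]
    constructor
    · intro hq
      obtain ⟨r, hqr, hrf⟩ := exists_rat_btwn hq
      obtain ⟨N, hN⟩ := eventually_atTop.1 ((h a).eventually (lt_mem_nhds hrf))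
      exact ⟨(r, N), fun t => ⟨Rat.cast_lt.1 hqr, (lt_or_ge t N).imp id (hN t)⟩⟩
    · rintro ⟨⟨r, N⟩, hr⟩
      refine (Rat.cast_lt.2 (hr 0).1).trans_le (ge_of_tendsto (h a) ?_)
      filter_upwards [eventually_ge_atTop N] with t ht
      exact ((hr t).2.resolve_left ht.not_gt).le

theorem SigmaComputable.of_tendsto_of_tendsto {f : α → ℝ} {l : α → ℕ → ℝ} {g : α × ℕ × ℕ → ℝ}
    (hg : PrimrecPred fun p : (α × ℕ × ℕ) × ℚ => (p.2 : ℝ) < g p.1)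
    (hl : ∀ a n, Tendsto (fun t => g (a, n, t)) atTop (𝓝 (l a n)))
    (h : ∀ a, Tendsto (l a) atTop (𝓝 (f a))) : SigmaComputable 3 f := by
  -- `q < f a` iff for some rational `r > q` all but finitely many `l a n` are at least `r`. For the
  -- convergent sequence `g (a, n, ·)` the bound `r ≤ l a n` is a `Π⁰₂` condition: each rational
  -- `s < r` is exceeded infinitely often.
  refine isSigma_three (β := ℚ × ℕ) (γ := ℕ × ℚ × ℕ) (δ := ℕ)
    (P := fun p b c t => p.2 < b.1 ∧ (c.1 < b.2 ∨ ¬c.2.1 < b.1 ∨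
      (¬t < c.2.2 ∧ (c.2.1 : ℝ) < g (p.1, c.1, t)))) ?_ ?_
  · have hb : Primrec fun p : (α × ℚ) × (ℚ × ℕ) × (ℕ × ℚ × ℕ) × ℕ => p.2.1 :=
      Primrec.fst.comp Primrec.snd
    have hc : Primrec fun p : (α × ℚ) × (ℚ × ℕ) × (ℕ × ℚ × ℕ) × ℕ => p.2.2.1 :=
      Primrec.fst.comp (Primrec.snd.comp Primrec.snd)
    have ht : Primrec fun p : (α × ℚ) × (ℚ × ℕ) × (ℕ × ℚ × ℕ) × ℕ => p.2.2.2 :=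
      Primrec.snd.comp (Primrec.snd.comp Primrec.snd)
    have hr := Primrec.fst.comp hb
    have hs := Primrec.fst.comp (Primrec.snd.comp hc)
    refine (Rat.primrecRel_lt.comp (Primrec.snd.comp Primrec.fst) hr).and
      ((Primrec.nat_lt.comp (Primrec.fst.comp hc) (Primrec.snd.comp hb)).or
        ((Rat.primrecRel_lt.comp hs hr).not.or
          ((Primrec.nat_lt.comp ht (Primrec.snd.comp (Primrec.snd.comp hc))).not.and ?_)))
    exact hg.comp (((Primrec.fst.comp Primrec.fst).pair ((Primrec.fst.comp hc).pair ht)).pair hs)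
  · rintro ⟨a, q⟩
    simp only [Set.mem_ofPred_eq, gt_iff_lt]
    constructor
    · intro hq
      obtain ⟨r, hqr, hrf⟩ := exists_rat_btwn hq
      obtain ⟨N, hN⟩ := eventually_atTop.1 ((h a).eventually (lt_mem_nhds hrf))
      refine ⟨(r, N), ?_⟩
      rintro ⟨n, s, T⟩
      by_cases hn : n < N
      · exact ⟨0, Rat.cast_lt.1 hqr, Or.inl hn⟩
      by_cases hs : s < r
      · have hsl : (s : ℝ) < l a n := (Rat.cast_lt.2 hs).trans (hN n (not_lt.1 hn))
        obtain ⟨t, hst, hTt⟩ :=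
          (((hl a n).eventually (lt_mem_nhds hsl)).and (eventually_ge_atTop T)).exists
        exact ⟨t, Rat.cast_lt.1 hqr, Or.inr (Or.inr ⟨hTt.not_gt, hst⟩)⟩
      · exact ⟨0, Rat.cast_lt.1 hqr, Or.inr (Or.inl hs)⟩
    · rintro ⟨⟨r, N⟩, hr⟩
      obtain ⟨_, hqr, -⟩ := hr (0, 0, 0)
      refine (Rat.cast_lt.2 hqr).trans_le (ge_of_tendsto (h a) ?_)
      filter_upwards [eventually_ge_atTop N] with n hn
      by_contra hlr
      obtain ⟨s, hls, hs⟩ := exists_rat_btwn (not_le.1 hlr)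
      obtain ⟨T, hT⟩ := eventually_atTop.1 ((hl a n).eventually (gt_mem_nhds hls))
      obtain ⟨t, -, h' | h' | ⟨hTt, hst⟩⟩ := hr (n, s, T)
      · exact hn.not_gt h'
      · exact h' (Rat.cast_lt.1 hs)
      · exact (hT t (not_lt.1 hTt)).not_gt hst

theorem primrecPred_cast_lt_neg_natCast_div {A B : α → ℕ} (hA : Primrec A) (hB : Primrec B) :
    PrimrecPred fun p : α × ℚ => (p.2 : ℝ) < -((A p.1 : ℝ) / B p.1) :=
  ((primrecPred_natCast_div_lt_cast hA hB).comp
    (Primrec.fst.pair (Rat.primrec_neg.comp Primrec.snd))).of_eq fun p => by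
      rw [Rat.cast_neg, lt_neg]

/-- The limit of a computable sequence of rationals is `Δ⁰₂`-computable. -/
theorem DeltaComputable.of_tendsto {f : α → ℝ} {A B : α × ℕ → ℕ} (hA : Primrec A) (hB : Primrec B)
    (h : ∀ a, Tendsto (fun t => (A (a, t) : ℝ) / B (a, t)) atTop (𝓝 (f a))) :
    DeltaComputable 2 f :=
  ⟨SigmaComputable.of_tendsto (g := fun p => (A p : ℝ) / B p)
    (primrecPred_cast_lt_natCast_div hA hB) h,
  PiComputable.of_neg (SigmaComputable.of_tendsto (g := fun p => -((A p : ℝ) / B p))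
    (primrecPred_cast_lt_neg_natCast_div hA hB) fun a => (h a).neg)⟩

/-- An iterated limit of a computable double sequence of rationals is `Δ⁰₃`-computable. -/
theorem DeltaComputable.of_tendsto_of_tendsto {f : α → ℝ} {l : α → ℕ → ℝ} {A B : α × ℕ × ℕ → ℕ}
    (hA : Primrec A) (hB : Primrec B)
    (hl : ∀ a n, Tendsto (fun t => (A (a, n, t) : ℝ) / B (a, n, t)) atTop (𝓝 (l a n)))
    (h : ∀ a, Tendsto (l a) atTop (𝓝 (f a))) : DeltaComputable 3 f :=
  ⟨SigmaComputable.of_tendsto_of_tendsto (g := fun p => (A p : ℝ) / B p)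
    (primrecPred_cast_lt_natCast_div hA hB) hl h,
  PiComputable.of_neg (SigmaComputable.of_tendsto_of_tendsto (g := fun p => -((A p : ℝ) / B p))
    (primrecPred_cast_lt_neg_natCast_div hA hB) (fun a n => (hl a n).neg) fun a => (h a).neg)⟩

end Hierarchy

/-! ### Complexity of `M`, of the measure mixture and of their normalizations -/

section Complexity

variable {X : Type*} {U : MonotoneTM X}

theorem programFreq_div_programFreq (x y : List X) (m n t : ℕ) :
    programFreq U x m t / programFreq U y n t =
      ((goodPrograms U x m t).card : ℝ) / (goodPrograms U y n t).card := by
  unfold programFreq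
  rw [div_div_div_cancel_right₀ (by positivity)]

theorem tendsto_card_div_card [Nonempty X] (hU : U.IsUniversal) (x y : List X) (n : ℕ) :
    Tendsto (fun t => ((goodPrograms U y n t).card : ℝ) / (goodPrograms U x n t).card) atTop
      (𝓝 (extensionProb U y n / extensionProb U x n)) := by
  simp_rw [← programFreq_div_programFreq]
  exact (tendsto_programFreq y n).div (tendsto_programFreq x n) (extensionProb_pos hU x n).ne'

/-- The numerators of `tendsto_prod_programFreq`. -/
noncomputable def normNum (U : MonotoneTM X) (x : List X) (n t : ℕ) : ℕ :=
  ∏ i ∈ Finset.range x.length, (goodPrograms U (x.take (i + 1)) n t).card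

/-- The denominators of `tendsto_prod_programFreq`. -/
noncomputable def normDen (U : MonotoneTM X) (x : List X) (n t : ℕ) : ℕ :=
  ∏ i ∈ Finset.range x.length, (goodPrograms U (x.take i) (n + 1) t).card

theorem tendsto_normNum_div_normDen [Nonempty X] (hU : U.IsUniversal) (x : List X) (n : ℕ) :
    Tendsto (fun t => (normNum U x n t : ℝ) / normDen U x n t) atTop
      (𝓝 (∏ i ∈ Finset.range x.length,
        extensionProb U (x.take (i + 1)) n / extensionProb U (x.take i) (n + 1))) := by
  refine (tendsto_prod_programFreq hU x n).congr fun t => ?_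
  simp only [programFreq_div_programFreq, normNum, normDen, Nat.cast_prod, Finset.prod_div_distrib]

/-- A quotient of two fractions as a single fraction, as `DeltaComputable.of_tendsto` needs it. -/
theorem tendsto_normNum_mul_div_normDen_mul [Nonempty X] (hU : U.IsUniversal) (x y : List X)
    (n : ℕ) :
    Tendsto (fun t => ((normNum U y n t * normDen U x n t : ℕ) : ℝ) /
        (normDen U y n t * normNum U x n t : ℕ)) atTop
      (𝓝 ((∏ i ∈ Finset.range y.length,
          extensionProb U (y.take (i + 1)) n / extensionProb U (y.take i) (n + 1)) /
        ∏ i ∈ Finset.range x.length,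
          extensionProb U (x.take (i + 1)) n / extensionProb U (x.take i) (n + 1))) := by
  refine ((tendsto_normNum_div_normDen hU y n).div (tendsto_normNum_div_normDen hU x n)
    (Finset.prod_pos fun _ _ => div_pos (extensionProb_pos hU _ _)
      (extensionProb_pos hU _ _)).ne').congr fun t => ?_
  rw [Pi.div_apply, div_div_div_eq]
  push_cast
  rfl

/-- Counting programs is primitive recursive. -/
theorem primrec_card_goodPrograms [Primcodable X] (U : MonotoneTM X) {α : Type*} [Primcodable α]
    {x : α → List X} {n t : α → ℕ} (hx : Primrec x) (hn : Primrec n) (ht : Primrec t) :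
    Primrec fun a => (goodPrograms U (x a) (n a) (t a)).card := by
  classical
  have hbits : Primrec bitStrings := by
    refine (Primrec.nat_rec₁ (f := fun _ l => l.flatMap fun p => [false :: p, true :: p]) [[]]
      ?_).of_eq fun t => ?_
    · refine Primrec.list_flatMap Primrec.snd ?_
      exact Primrec.list_cons.comp (Primrec.list_cons.comp (Primrec.const false) Primrec.snd)
        (Primrec.list_cons.comp (Primrec.list_cons.comp (Primrec.const true) Primrec.snd)
          (Primrec.const []))
    · induction t with
      | zero => rfl
      | succ t ih => rw [bitStrings, ← ih]
  let R : List Bool → List X × ℕ × ℕ → Prop := fun p b =>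
    b.1 <+: U.outputAt p b.2.2 ∧ b.1.length + b.2.1 ≤ (U.outputAt p b.2.2).length
  have hR : PrimrecRel R := by
    have hx : Primrec fun c : List Bool × List X × ℕ × ℕ => c.2.1 := Primrec.fst.comp Primrec.snd
    have hn : Primrec fun c : List Bool × List X × ℕ × ℕ => c.2.2.1 :=
      Primrec.fst.comp (Primrec.snd.comp Primrec.snd)
    have hu : Primrec fun c : List Bool × List X × ℕ × ℕ => U.outputAt c.1 c.2.2.2 :=
      U.primrec_outputAt.comp Primrec.fst (Primrec.snd.comp (Primrec.snd.comp Primrec.snd))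
    have hpre : PrimrecPred fun c : List Bool × List X × ℕ × ℕ =>
        c.2.1 <+: U.outputAt c.1 c.2.2.2 :=
      (Primrec.eq.comp hx (Primrec.list_take.comp (Primrec.list_length.comp hx) hu)).of_eq
        fun _ => List.prefix_iff_eq_take.symm
    exact hpre.and (Primrec.nat_le.comp (Primrec.nat_add.comp (Primrec.list_length.comp hx) hn)
      (Primrec.list_length.comp hu))
  refine (Primrec.list_length.comp (hR.listFilter.comp (hbits.comp ht)
    (hx.pair (hn.pair ht)))).of_eq fun a => ?_
  rw [← List.toFinset_card_of_nodup ((nodup_bitStrings _).filter _)]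
  congr 1
  ext p
  simp [mem_goodPrograms, mem_bitStrings, R]

variable [Primcodable X]

theorem solomonoffM_lowerSemicomputable : LowerSemicomputable (solomonoffM U) := by
  refine isSigma_one (β := ℕ)
    (P := fun p t => (p.2 : ℝ) < ((goodPrograms U p.1 0 t).card : ℝ) / (2 ^ t : ℕ)) ?_ ?_
  · refine (primrecPred_cast_lt_natCast_div (α := List X × ℕ)
      (A := fun a => (goodPrograms U a.1 0 a.2).card) (B := fun a => 2 ^ a.2) ?_ ?_).comp
      (((Primrec.fst.comp Primrec.fst).pair Primrec.snd).pair (Primrec.snd.comp Primrec.fst))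
    · exact primrec_card_goodPrograms U Primrec.fst (Primrec.const 0) Primrec.snd
    · exact Primrec.nat_pow.comp (Primrec.const 2) Primrec.snd
  · rintro ⟨x, q⟩
    refine (lt_isLUB_iff isLUB_programFreq).trans (Set.exists_range_iff.trans ?_)
    simp [programFreq]

theorem measureMixture_piComputable [Fintype X] :
    PiComputable 2 (measureMixture (solomonoffM U)) := by
  -- The mixture is below `q` iff for some `n` the frequencies stay below some rational `r < q`.
  refine isSigma_two (β := ℕ × ℚ) (γ := ℕ) (P := fun p b t => b.2 < p.2 ∧
    ¬((b.2 : ℝ) < ((goodPrograms U p.1 b.1 t).card : ℝ) / (2 ^ t : ℕ))) ?_ ?_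
  · have hb : Primrec fun p : (List X × ℚ) × (ℕ × ℚ) × ℕ => p.2.1 := Primrec.fst.comp Primrec.snd
    have hr := Primrec.snd.comp hb
    refine (Rat.primrecRel_lt.comp hr (Primrec.snd.comp Primrec.fst)).and (PrimrecPred.not ?_)
    refine (primrecPred_cast_lt_natCast_div (α := List X × ℕ × ℕ)
      (A := fun a => (goodPrograms U a.1 a.2.1 a.2.2).card) (B := fun a => 2 ^ a.2.2) ?_ ?_).comp
      (((Primrec.fst.comp Primrec.fst).pair ((Primrec.fst.comp hb).pair
        (Primrec.snd.comp Primrec.snd))).pair hr)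
    · exact primrec_card_goodPrograms U Primrec.fst (Primrec.fst.comp Primrec.snd)
        (Primrec.snd.comp Primrec.snd)
    · exact Primrec.nat_pow.comp (Primrec.const 2) (Primrec.snd.comp Primrec.snd)
  · rintro ⟨x, q⟩
    have hfreq : ∀ n t, ((goodPrograms U x n t).card : ℝ) / (2 ^ t : ℕ) = programFreq U x n t := by
      simp [programFreq]
    simp only [Set.mem_compl_iff, Set.mem_ofPred_eq, ge_iff_le, not_le, not_lt, hfreq]
    constructor
    · intro hq
      obtain ⟨n, hn⟩ := ((tendsto_extensionProb x).eventually (gt_mem_nhds hq)).exists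
      obtain ⟨r, hnr, hrq⟩ := exists_rat_btwn hn
      exact ⟨(n, r), fun t => ⟨Rat.cast_lt.1 hrq,
        (programFreq_le_extensionProb x n t).trans hnr.le⟩⟩
    · rintro ⟨⟨n, r⟩, hr⟩
      exact ((measureMixture_le_extensionProb x n).trans (ciSup_le fun t => (hr t).2)).trans_lt
        (Rat.cast_lt.2 (hr 0).1)

theorem primrec_normNum (U : MonotoneTM X) {α : Type*} [Primcodable α]
    {x : α → List X} {n t : α → ℕ} (hx : Primrec x) (hn : Primrec n) (ht : Primrec t) :
    Primrec fun a => normNum U (x a) (n a) (t a) :=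
  Primrec.finset_prod_range (Primrec.list_length.comp hx) (primrec_card_goodPrograms U
    (Primrec.list_take.comp (Primrec.succ.comp Primrec.snd) (hx.comp Primrec.fst))
    (hn.comp Primrec.fst) (ht.comp Primrec.fst))

theorem primrec_normDen (U : MonotoneTM X) {α : Type*} [Primcodable α]
    {x : α → List X} {n t : α → ℕ} (hx : Primrec x) (hn : Primrec n) (ht : Primrec t) :
    Primrec fun a => normDen U (x a) (n a) (t a) :=
  Primrec.finset_prod_range (Primrec.list_length.comp hx) (primrec_card_goodPrograms U
    (Primrec.list_take.comp Primrec.snd (hx.comp Primrec.fst))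
    (Primrec.succ.comp (hn.comp Primrec.fst)) (ht.comp Primrec.fst))

theorem primrec_append_pair {α : Type*} [Primcodable α] {p : α → List X × List X}
    (hp : Primrec p) : Primrec fun a => (p a).1 ++ (p a).2 :=
  Primrec.list_append.comp (Primrec.fst.comp hp) (Primrec.snd.comp hp)

variable [Nonempty X]

theorem conditional_solomonoffM_limitComputable (hU : U.IsUniversal) :
    LimitComputable (conditional (solomonoffM U)) := by
  refine DeltaComputable.of_tendsto
    (A := fun a => (goodPrograms U (a.1.1 ++ a.1.2) 0 a.2).card)
    (B := fun a => (goodPrograms U a.1.1 0 a.2).card)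
    (primrec_card_goodPrograms U (primrec_append_pair Primrec.fst) (Primrec.const 0) Primrec.snd)
    (primrec_card_goodPrograms U (Primrec.fst.comp Primrec.fst) (Primrec.const 0) Primrec.snd)
    fun p => ?_
  unfold conditional
  rw [← extensionProb_zero, ← extensionProb_zero]
  exact tendsto_card_div_card hU p.1 (p.1 ++ p.2) 0

variable [Fintype X]

theorem solomonoffNorm_solomonoffM_limitComputable (hU : U.IsUniversal) :
    LimitComputable (solomonoffNorm (solomonoffM U)) := by
  refine DeltaComputable.of_tendsto
    (A := fun a => normNum U a.1 0 a.2) (B := fun a => normDen U a.1 0 a.2)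
    (primrec_normNum U Primrec.fst (Primrec.const 0) Primrec.snd)
    (primrec_normDen U Primrec.fst (Primrec.const 0) Primrec.snd) fun x => ?_
  rw [solomonoffNorm_solomonoffM]
  exact tendsto_normNum_div_normDen hU x 0

theorem conditional_solomonoffNorm_solomonoffM_limitComputable (hU : U.IsUniversal) :
    LimitComputable (conditional (solomonoffNorm (solomonoffM U))) := by
  have hx : Primrec fun a : (List X × List X) × ℕ => a.1.1 := Primrec.fst.comp Primrec.fst
  have hxy : Primrec fun a : (List X × List X) × ℕ => a.1.1 ++ a.1.2 :=
    primrec_append_pair Primrec.fst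
  refine DeltaComputable.of_tendsto
    (A := fun a => normNum U (a.1.1 ++ a.1.2) 0 a.2 * normDen U a.1.1 0 a.2)
    (B := fun a => normDen U (a.1.1 ++ a.1.2) 0 a.2 * normNum U a.1.1 0 a.2)
    (Primrec.nat_mul.comp (primrec_normNum U hxy (Primrec.const 0) Primrec.snd)
      (primrec_normDen U hx (Primrec.const 0) Primrec.snd))
    (Primrec.nat_mul.comp (primrec_normDen U hxy (Primrec.const 0) Primrec.snd)
      (primrec_normNum U hx (Primrec.const 0) Primrec.snd)) fun p => ?_
  unfold conditional
  rw [solomonoffNorm_solomonoffM, solomonoffNorm_solomonoffM]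
  exact tendsto_normNum_mul_div_normDen_mul hU p.1 (p.1 ++ p.2) 0

theorem conditional_measureMixture_deltaComputable (hU : U.IsUniversal) :
    DeltaComputable 3 (conditional (measureMixture (solomonoffM U))) :=
  DeltaComputable.of_tendsto_of_tendsto
    (A := fun a => (goodPrograms U (a.1.1 ++ a.1.2) a.2.1 a.2.2).card)
    (B := fun a => (goodPrograms U a.1.1 a.2.1 a.2.2).card)
    (primrec_card_goodPrograms U (primrec_append_pair Primrec.fst)
      (Primrec.fst.comp Primrec.snd) (Primrec.snd.comp Primrec.snd))
    (primrec_card_goodPrograms U (Primrec.fst.comp Primrec.fst)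
      (Primrec.fst.comp Primrec.snd) (Primrec.snd.comp Primrec.snd))
    (fun p n => tendsto_card_div_card hU p.1 (p.1 ++ p.2) n) fun _ =>
    (tendsto_extensionProb _).div (tendsto_extensionProb _) (measureMixture_pos hU _).ne'

theorem solomonoffNorm_measureMixture_deltaComputable (hU : U.IsUniversal) :
    DeltaComputable 3 (solomonoffNorm (measureMixture (solomonoffM U))) :=
  DeltaComputable.of_tendsto_of_tendsto
    (A := fun a => normNum U a.1 a.2.1 a.2.2) (B := fun a => normDen U a.1 a.2.1 a.2.2)
    (primrec_normNum U Primrec.fst (Primrec.fst.comp Primrec.snd) (Primrec.snd.comp Primrec.snd))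
    (primrec_normDen U Primrec.fst (Primrec.fst.comp Primrec.snd) (Primrec.snd.comp Primrec.snd))
    (fun x n => tendsto_normNum_div_normDen hU x n) fun x => tendsto_prod_extensionProb hU x

theorem conditional_solomonoffNorm_measureMixture_deltaComputable (hU : U.IsUniversal) :
    DeltaComputable 3 (conditional (solomonoffNorm (measureMixture (solomonoffM U)))) := by
  have hx : Primrec fun a : (List X × List X) × ℕ × ℕ => a.1.1 := Primrec.fst.comp Primrec.fst
  have hxy : Primrec fun a : (List X × List X) × ℕ × ℕ => a.1.1 ++ a.1.2 :=
    primrec_append_pair Primrec.fst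
  have hn : Primrec fun a : (List X × List X) × ℕ × ℕ => a.2.1 := Primrec.fst.comp Primrec.snd
  have ht : Primrec fun a : (List X × List X) × ℕ × ℕ => a.2.2 := Primrec.snd.comp Primrec.snd
  exact DeltaComputable.of_tendsto_of_tendsto
    (A := fun a => normNum U (a.1.1 ++ a.1.2) a.2.1 a.2.2 * normDen U a.1.1 a.2.1 a.2.2)
    (B := fun a => normDen U (a.1.1 ++ a.1.2) a.2.1 a.2.2 * normNum U a.1.1 a.2.1 a.2.2)
    (Primrec.nat_mul.comp (primrec_normNum U hxy hn ht) (primrec_normDen U hx hn ht))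
    (Primrec.nat_mul.comp (primrec_normDen U hxy hn ht) (primrec_normNum U hx hn ht))
    (fun p n => tendsto_normNum_mul_div_normDen_mul hU p.1 (p.1 ++ p.2) n) fun _ =>
    (tendsto_prod_extensionProb hU _).div (tendsto_prod_extensionProb hU _)
      (solomonoffNorm_measureMixture_pos hU _).ne'

end Complexity

theorem theorem1 {X : Type*} [Fintype X] [Nonempty X] [Primcodable X]
    (U : MonotoneTM X) (hU : U.IsUniversal) :
    LowerSemicomputable (solomonoffM U) ∧
    LimitComputable (conditional (solomonoffM U)) ∧
    LimitComputable (solomonoffNorm (solomonoffM U)) ∧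
    LimitComputable (conditional (solomonoffNorm (solomonoffM U))) ∧
    PiComputable 2 (measureMixture (solomonoffM U)) ∧
    DeltaComputable 3 (conditional (measureMixture (solomonoffM U))) ∧
    DeltaComputable 3 (solomonoffNorm (measureMixture (solomonoffM U))) ∧
    DeltaComputable 3 (conditional (solomonoffNorm (measureMixture (solomonoffM U)))) := by
  exact ⟨solomonoffM_lowerSemicomputable, conditional_solomonoffM_limitComputable hU,
    solomonoffNorm_solomonoffM_limitComputable hU,
    conditional_solomonoffNorm_solomonoffM_limitComputable hU, measureMixture_piComputable,
    conditional_measureMixture_deltaComputable hU,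
    solomonoffNorm_measureMixture_deltaComputable hU,
    conditional_solomonoffNorm_measureMixture_deltaComputable hU⟩
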